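/- **Setting.** Let $\mathcal C$ (customers) and $\mathcal P$ (providers) be finite nonempty disjoint sets, $\mathcal A=\mathcal C\cup\mathcal P$. A matching $X\subseteq\mathcal C\times\mathcal P$ is a set of pairwise disjoint pairs; $\mu_X(a)$ is the partner of $a$, or $a$ itself if $a$ is unmatched. Let $u:\mathcal A\times\mathcal A\to[-1,1]$, with $u_a(b)=u(a,b)=0$ if $a,b$ are on the same side (in particular $u_a(a)=0$). For utilities $v$ put $W_v(X)=\sum_{a\in\mathcal A}v_a(\mu_X(a))$. *Dual prices* for $v$ are $p\in\mathbb R_{\ge0}^{\mathcal A}$ with $p_c+p_q\ge v_c(q)+v_q(c)$ for all $(c,q)\in\mathcal C\times\mathcal P$; they are *optimal* if $\sum_a p_a$ is minimal. A market outcome $(X,\tau)$, $\tau\in\mathbb R^{\mathcal A}$, is *stable* if $u_a(\mu_X(a))+\tau_a\ge0$ for all $a$ and $u_c(\mu_X(c))+\tau_c+u_q(\mu_X(q))+\tau_q\ge u_c(q)+u_q(c)$ for all $(c,q)\in\mathcal C\times\mathcal P$. Its *Subset Instability* is $$I(u;X,\tau)=\max_{S\subseteq\mathcal A}\Bigl[\max_{X'\text{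 matching within }S}\ \sum_{a\in S}u_a(\mu_{X'}(a))-\sum_{a\in S}\bigl(u_a(\mu_X(a))+\tau_a\bigr)\Bigr].$$ **Learning.** All agents of $\mathcal A$ arrive in each of the rounds $t=1,\dots,T$ ($T\ge1$). In round $t$ the platform selects $(X^t,\tau^t)$ and then observes $u_a(\mu_{X^t}(a))+\varepsilon_{a,t}$ for every $a$, where the $\varepsilon_{a,t}$ are independent with $\mathbb E\,e^{\lambda\varepsilon_{a,t}}\le e^{\lambda^2/2}$ for all $\lambda\in\mathbb R$. The regret is $R_T=\sum_{t=1}^T I(u;X^t,\tau^t)$. **Algorithm MatchUCB′.** For $a,b$ on opposite sides keep a confidence interval $C_{a,b}$: it is $[-1,1]$ while $a,b$ have never been matched; after they have been matched $n\ge1$ times, with $m$ the mean of the feedback of $a$ in those rounds, it is $[m-r,m+r]$ with both endpoints clipped to $[-1,1]$, where $r=8\sqrt{\log(|\mathcal A|T)/n}$. Put $C_{a,b}=\{0\}$ for $a,b$ on the same side. Let $C'_{a,b}$ be the interval with the same centre as $C_{a,b}$ and twice its width, $v_a(b)=\max C_{a,b}$, $v'_a(b)=\max C'_{a,b}$. In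 each round compute: 1. a matching $X_1$ maximizing $W_v$, and $\delta=\frac1{|\mathcal A|}\min_{X\ne X_1}\bigl(W_v(X_1)-W_v(X)\bigr)$; 2. optimal dual prices for the utilities obtained from $v$ by lowering $v_a(\mu_{X_1}(a))$ by $\delta$ for every matched agent $a$; then $p_1$, by raising these prices by $\delta$ for every agent matched in $X_1$; 3. a matching $X_2$ maximizing $W_{v'}$ and optimal dual prices $p_2$ for $v'$. If $X_1\ne X_2$, select $X_2$ with transfers $\tau_a=p_{2,a}-v'_a(\mu_{X_2}(a))$ for matched $a$; if $X_1=X_2$, select $X_1$ with $\tau_a=p_{1,a}-v_a(\mu_{X_1}(a))$ for matched $a$; unmatched agents get $\tau_a=0$. Where optimal solutions are not unique, $(X^t,\tau^t)$ may be chosen by any measurable rule depending on the past only (that is, on $\varepsilon_{a,s}$, $a\in\mathcal A$, $s<t$). **Theorem.** There is an absolute constant $K>0$ such that the following holds for all $\mathcal C,\mathcal P,u$, noise, choices of the algorithm, and $T\ge1$. Let $X^{\mathrm{opt}}$ maximize $W_u$ and suppose $\Delta=\min_{X\ne X^{\mathrm{opt}}}\bigl(W_u(X^{\mathrm{opt}})-W_u(X)\bigr)>0$.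 Put $B=K\,|\mathcal A|^5\log(|\mathcal A|T)/\Delta^2$. Then MatchUCB′ satisfies $\mathbb E(R_T)\le B$. Moreover, the number $M$ of rounds $t\le T$ in which $(X^t,\tau^t)$ is not stable with respect to $u$ satisfies $\mathbb E(M)\le B$ and $\Pr(M>B)\le|\mathcal A|^{-2}T^{-2}$. -/

import Mathlib

open MeasureTheory ProbabilityTheory

noncomputable section

namespace MatchingMarket

/-- The agents of a two-sided market with customers `C` and providers `P`. -/
abbrev Agent (C P : Type*) := C ⊕ P

/-- A matching: a set of pairwise disjoint (customer, provider) pairs. -/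
@[ext]
structure Matching (C P : Type*) where
  pairs : Finset (C × P)
  provider_unique : ∀ c p p', (c, p) ∈ pairs → (c, p') ∈ pairs → p = p'
  customer_unique : ∀ c c' p, (c, p) ∈ pairs → (c', p) ∈ pairs → c = c'

/-- Matchings form a finite set, which carries the discrete sigma-algebra. -/
instance (C P : Type*) : MeasurableSpace (Matching C P) := ⊤

instance (C P : Type*) [Finite C] [Finite P] : Finite (Matching C P) :=
  Finite.of_injective Matching.pairs (fun _ _ h => Matching.ext h)

section

variable {C P : Type*}

open Classical in
/-- The functional form of a matching: a matched agent is sent to its partner, an unmatched agent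
to itself. -/
def Matching.partner (X : Matching C P) : Agent C P → Agent C P
  | Sum.inl c => if h : ∃ p, (c, p) ∈ X.pairs then Sum.inr h.choose else Sum.inl c
  | Sum.inr p => if h : ∃ c, (c, p) ∈ X.pairs then Sum.inl h.choose else Sum.inr p

/-- `X` is a matching over the coalition `S`: only members of `S` are matched. -/
def Matching.Within (X : Matching C P) (S : Finset (Agent C P)) : Prop :=
  ∀ c p, (c, p) ∈ X.pairs → Sum.inl c ∈ S ∧ Sum.inr p ∈ S

/-- The two agents are on opposite sides of the market. -/
def OppositeSides (a b : Agent C P) : Prop := a.isLeft ≠ b.isLeft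

/-- Unstructured preferences: every utility lies in `[-1, 1]`; by convention an agent has utility
zero for itself (being unmatched) and for the agents on its own side. -/
def IsUnstructured (u : Agent C P → Agent C P → ℝ) : Prop :=
  (∀ a b, u a b ∈ Set.Icc (-1 : ℝ) 1) ∧ ∀ a b, ¬ OppositeSides a b → u a b = 0

/-- The market outcome `(X, τ)` is stable: individually rational, without blocking pairs. -/
def IsStable (u : Agent C P → Agent C P → ℝ) (X : Matching C P) (τ : Agent C P → ℝ) : Prop :=
  (∀ a, 0 ≤ u a (X.partner a) + τ a) ∧
  ∀ (c : C) (p : P),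
    u (Sum.inl c) (Sum.inr p) + u (Sum.inr p) (Sum.inl c) ≤
      (u (Sum.inl c) (X.partner (Sum.inl c)) + τ (Sum.inl c)) +
      (u (Sum.inr p) (X.partner (Sum.inr p)) + τ (Sum.inr p))

/-- Subset Instability: the maximum over coalitions `S` of the best total utility of a matching
within `S`, minus the total net utility of `S` under `(X, τ)`. (Both suprema are over finite
nonempty types, so they are maxima.) -/
def instability (u : Agent C P → Agent C P → ℝ) (X : Matching C P) (τ : Agent C P → ℝ) : ℝ :=
  ⨆ S : Finset (Agent C P),
    ((⨆ Y : {Y : Matching C P // Y.Within S}, ∑ a ∈ S, u a (Y.1.partner a)) -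
      ∑ a ∈ S, (u a (X.partner a) + τ a))

variable [Fintype C] [Fintype P]

/-- The total utility of a matching. -/
def weight (u : Agent C P → Agent C P → ℝ) (X : Matching C P) : ℝ :=
  ∑ a, u a (X.partner a)

/-- `X` is a maximum weight matching for `u`, i.e. an (integral) solution of the primal program. -/
def IsMaxWeight (u : Agent C P → Agent C P → ℝ) (X : Matching C P) : Prop :=
  ∀ Y, weight u Y ≤ weight u X

/-- The smallest loss of total utility of a matching other than `X`, compared to `X`. (If both sides
of the market are nonempty, this is a minimum over a finite nonempty set.) -/
def gap (u : Agent C P → Agent C P → ℝ) (X : Matching C P) : ℝ :=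
  ⨅ Y : {Y : Matching C P // Y ≠ X}, (weight u X - weight u Y.1)

/-- Feasible prices of the dual program for `u`. -/
def IsDualFeasible (u : Agent C P → Agent C P → ℝ) (p : Agent C P → ℝ) : Prop :=
  (∀ (c : C) (q : P), u (Sum.inl c) (Sum.inr q) + u (Sum.inr q) (Sum.inl c) ≤
    p (Sum.inl c) + p (Sum.inr q)) ∧ ∀ a, 0 ≤ p a

/-- Optimal prices of the dual program for `u`. -/
def IsOptimalDual (u : Agent C P → Agent C P → ℝ) (p : Agent C P → ℝ) : Prop :=
  IsDualFeasible u p ∧ ∀ q, IsDualFeasible u q → ∑ a, p a ≤ ∑ a, q a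

/-- A collection of confidence intervals, given by their lower (`.1`) and upper (`.2`) endpoints. -/
abbrev ConfSets (C P : Type*) := Agent C P → Agent C P → ℝ × ℝ

/-- The upper confidence bounds. -/
def ucb (I : ConfSets C P) : Agent C P → Agent C P → ℝ := fun a b => (I a b).2

/-- The confidence intervals expanded to twice their width, with the same centre. -/
def expand (I : ConfSets C P) : ConfSets C P := fun a b =>
  ((I a b).1 - ((I a b).2 - (I a b).1) / 2, (I a b).2 + ((I a b).2 - (I a b).1) / 2)

open Classical in
/-- The utilities `v`, lowered by `δ` on the matched pairs of `X`. -/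
def lowerOn (v : Agent C P → Agent C P → ℝ) (X : Matching C P) (δ : ℝ) :
    Agent C P → Agent C P → ℝ := fun a b =>
  if X.partner a = b ∧ a ≠ b then v a b - δ else v a b

open Classical in
/-- The prices `p`, raised by `δ` for the matched agents of `X`. -/
def raiseOn (p : Agent C P → ℝ) (X : Matching C P) (δ : ℝ) : Agent C P → ℝ := fun a =>
  if X.partner a ≠ a then p a + δ else p a

open Classical in
/-- The transfers that realize the prices `p` for utilities `v` under the matching `X`; unmatched
agents receive no transfer. -/
def transfersOf (v : Agent C P → Agent C P → ℝ) (X : Matching C P) (p : Agent C P → ℝ) :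
    Agent C P → ℝ := fun a =>
  if X.partner a ≠ a then p a - v a (X.partner a) else 0

/-- `δ` of the robust dual: the gap of `X` for the upper confidence bounds, divided by the number
of agents. -/
def robustShift (I : ConfSets C P) (X : Matching C P) : ℝ :=
  gap (ucb I) X / Fintype.card (Agent C P)

/-- `(X, τ)` is an admissible output of the modified `ComputeMatch` on the confidence sets `I`.
Here `X₁` is a maximum weight matching for the upper confidence bounds and `p'` an optimal dual
solution for these bounds lowered by `robustShift` on the pairs of `X₁`; raising `p'` by the same
amount on matched agents gives the robust dual solution. `(X₂, p₂)` is an optimal primal-dual pair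
for the upper bounds of the expanded confidence sets. If `X₁ ≠ X₂` the output comes from
`(X₂, p₂)`, otherwise from `X₁` and the robust dual. -/
def IsComputeMatchOutput (I : ConfSets C P) (X : Matching C P) (τ : Agent C P → ℝ) : Prop :=
  ∃ (X₁ : Matching C P) (p' : Agent C P → ℝ) (X₂ : Matching C P) (p₂ : Agent C P → ℝ),
    IsMaxWeight (ucb I) X₁ ∧
    IsOptimalDual (lowerOn (ucb I) X₁ (robustShift I X₁)) p' ∧
    IsMaxWeight (ucb (expand I)) X₂ ∧
    IsOptimalDual (ucb (expand I)) p₂ ∧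
    ((X₁ ≠ X₂ ∧ X = X₂ ∧ τ = transfersOf (ucb (expand I)) X₂ p₂) ∨
     (X₁ = X₂ ∧ X = X₁ ∧ τ = transfersOf (ucb I) X₁ (raiseOn p' X₁ (robustShift I X₁))))

open Classical in
/-- The number of rounds before round `t` in which `a` was matched to `b` (for `a ≠ b`). -/
def matchCount (X : ℕ → Matching C P) (t : ℕ) (a b : Agent C P) : ℕ :=
  ((Finset.range t).filter (fun s => (X s).partner a = b)).card

open Classical in
/-- The empirical mean of the feedback `y s a` of `a` over the rounds before round `t` in which `a`
was matched to `b`. -/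
def empMean (X : ℕ → Matching C P) (y : ℕ → Agent C P → ℝ) (t : ℕ) (a b : Agent C P) : ℝ :=
  (∑ s ∈ (Finset.range t).filter (fun s => (X s).partner a = b), y s a) / matchCount X t a b

/-- The point of `[-1, 1]` nearest to `x`. -/
def clip (x : ℝ) : ℝ := max (-1) (min 1 x)

/-- The radius `8 √(log (|A| T) / n)` of the confidence interval after `n` observations. -/
def radius (N T n : ℕ) : ℝ := 8 * Real.sqrt (Real.log ((N : ℝ) * T) / n)

open Classical in
/-- The confidence intervals at the start of round `t` (rounds are numbered from `0`): `[-1, 1]` for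
a pair that was never matched, else the interval of the given radius around the empirical mean,
clipped to `[-1, 1]`. If `[m - r, m + r]` meets `[-1, 1]`, clipping the endpoints is intersecting
with `[-1, 1]`; otherwise it gives the nearest point of `[-1, 1]`. Pairs of agents that are not on
opposite sides have the known utility `0`. -/
def confSets (T : ℕ) (X : ℕ → Matching C P) (y : ℕ → Agent C P → ℝ) (t : ℕ) : ConfSets C P :=
  fun a b =>
    if OppositeSides a b then
      if matchCount X t a b = 0 then (-1, 1)
      else
        (clip (empMean X y t a b - radius (Fintype.card (Agent C P)) T (matchCount X t a b)),
         clip (empMean X y t a b + radius (Fintype.card (Agent C P)) T (matchCount X t a b)))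
    else (0, 0)

variable {Ω : Type*} [MeasurableSpace Ω]

/-- The noise variables `ε t a` are independent and `1`-subgaussian. -/
structure IsNoise (μ : Measure Ω) (ε : ℕ → Agent C P → Ω → ℝ) : Prop where
  measurable : ∀ t a, Measurable (ε t a)
  indep : iIndepFun (fun i : ℕ × Agent C P => ε i.1 i.2) μ
  subgaussian : ∀ t a, HasSubgaussianMGF (ε t a) 1 μ

/-- The sigma-algebra generated by the noise of the rounds before round `t`. -/
@[reducible]
def past (ε : ℕ → Agent C P → Ω → ℝ) (t : ℕ) : MeasurableSpace Ω :=
  ⨆ s ∈ Set.Iio t, ⨆ a, MeasurableSpace.comap (ε s a) inferInstance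

/-- The feedback of agent `a` in round `s`: the utility for its partner, plus noise. -/
def feedback (u : Agent C P → Agent C P → ℝ) (ε : ℕ → Agent C P → Ω → ℝ)
    (X : ℕ → Ω → Matching C P) (ω : Ω) (s : ℕ) (a : Agent C P) : ℝ :=
  u a ((X s ω).partner a) + ε s a ω

/-- `(X t, τ t)`, `t < T`, are the market outcomes selected by `MatchUCB'` with horizon `T`: in each
round the outcome is an admissible output of the modified `ComputeMatch` on the confidence sets
built from the feedback so far. The algorithm leaves open which optimal solutions are picked; this
may be any measurable function of the past. -/
structure IsMatchUCBRun (u : Agent C P → Agent C P → ℝ) (T : ℕ) (ε : ℕ → Agent C P → Ω → ℝ)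
    (X : ℕ → Ω → Matching C P) (τ : ℕ → Ω → Agent C P → ℝ) : Prop where
  measurable_matching : ∀ t < T, Measurable[past ε t] (X t)
  measurable_transfers : ∀ t < T, Measurable[past ε t] (τ t)
  output : ∀ t < T, ∀ ω,
    IsComputeMatchOutput (confSets T (fun s => X s ω) (feedback u ε X ω) t) (X t ω) (τ t ω)

/-- The regret: the cumulative instability over the `T` rounds. -/
def regret (u : Agent C P → Agent C P → ℝ) (T : ℕ)
    (X : ℕ → Ω → Matching C P) (τ : ℕ → Ω → Agent C P → ℝ) (ω : Ω) : ℝ :=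
  ∑ t ∈ Finset.range T, instability u (X t ω) (τ t ω)

open Classical in
/-- The number of rounds whose market outcome is not stable for the true utilities. -/
def unstableRounds (u : Agent C P → Agent C P → ℝ) (T : ℕ)
    (X : ℕ → Ω → Matching C P) (τ : ℕ → Ω → Agent C P → ℝ) (ω : Ω) : ℕ :=
  ((Finset.range T).filter (fun t => ¬ IsStable u (X t ω) (τ t ω))).card

/-- The order of growth `|A|⁵ log (|A| T) / Δ²`. -/
def rate (N T : ℕ) (Δ : ℝ) : ℝ := (N : ℝ) ^ 5 * Real.log ((N : ℝ) * T) / Δ ^ 2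

end

end MatchingMarket

end

/-! The proof separates a rare bad event from a deterministic argument. Write N for the number of
agents, v for the upper bounds and w for the widths of the confidence intervals. Outside an event of
probability at most 1/(NT)² (`IsNoise.measure_deviationEvent_le`) every interval used contains the
true utility.

Suppose this holds and the intervals of all selected pairs have width at most Δ/(16N). The selected
matching X is X₂ in both branches, and it maximizes W_v + W_w/2. The half width added to each bound
rewards uncertainty: since w is small on X, a competitor Y with wide intervals must already trail X
in W_v, while one with narrow intervals trails because of the true gap Δ. Hence X = X^opt = X₁, and
X leads by at least Δ/16 in W_v (`IsComputeMatchOutput.isStable`). So δ ≥ Δ/(16N) exceeds the widths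
on X, and raising the prices by δ compensates for the overestimated utilities. Lowering the
utilities by the same δ beforehand keeps the prices feasible for X, with price zero at unmatched
agents by complementary slackness, so the outcome is stable (`isStable_of_width_le_robustShift`).

An unstable round therefore selects a pair observed only O(N² log(NT)/Δ²) times, which happens at
most that often, up to 1, for each of the N² ordered pairs. This gives O(N⁴ log(NT)/Δ²) unstable
rounds. Stable rounds have no regret and the others at most 4N each, whence the fifth power of N. -/

noncomputable section

namespace MatchingMarket

/-! ### Matchings as sets of pairs and as partner maps -/

section Matchings

variable {C P : Type*}

lemma Matching.partner_inl_eq_inr (X : Matching C P) (c : C) (p : P) :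
    X.partner (Sum.inl c) = Sum.inr p ↔ (c, p) ∈ X.pairs := by
  unfold Matching.partner
  by_cases h : ∃ p, (c, p) ∈ X.pairs
  · simp only [h, dif_pos, Sum.inr.injEq]
    constructor
    · rintro rfl; exact h.choose_spec
    · intro hp; exact X.provider_unique c _ _ h.choose_spec hp
  · simp only [h, dif_neg, not_false_eq_true, reduceCtorEq, false_iff]
    exact fun hp => h ⟨p, hp⟩

lemma Matching.partner_inr_eq_inl (X : Matching C P) (c : C) (p : P) :
    X.partner (Sum.inr p) = Sum.inl c ↔ (c, p) ∈ X.pairs := by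
  unfold Matching.partner
  by_cases h : ∃ c, (c, p) ∈ X.pairs
  · simp only [h, dif_pos, Sum.inl.injEq]
    constructor
    · rintro rfl; exact h.choose_spec
    · intro hp; exact X.customer_unique _ _ p h.choose_spec hp
  · simp only [h, dif_neg, not_false_eq_true, reduceCtorEq, false_iff]
    exact fun hp => h ⟨c, hp⟩

lemma Matching.partner_inl_ne (X : Matching C P) (c : C) :
    X.partner (Sum.inl c) ≠ Sum.inl c ↔ ∃ p, (c, p) ∈ X.pairs := by
  unfold Matching.partner
  by_cases h : ∃ p, (c, p) ∈ X.pairs <;> simp [h]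

lemma Matching.partner_inr_ne (X : Matching C P) (p : P) :
    X.partner (Sum.inr p) ≠ Sum.inr p ↔ ∃ c, (c, p) ∈ X.pairs := by
  unfold Matching.partner
  by_cases h : ∃ c, (c, p) ∈ X.pairs <;> simp [h]

open Classical in
/-- A sum over a coalition splits into the contributions of the pairs of a matching within the
coalition and those of the unmatched agents. -/
lemma Matching.sum_eq_sum_pairs_add (X : Matching C P) {S : Finset (Agent C P)} (hS : X.Within S)
    (f : Agent C P → ℝ) :
    ∑ a ∈ S, f a = ∑ x ∈ X.pairs, (f (Sum.inl x.1) + f (Sum.inr x.2)) +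
      ∑ a ∈ S with X.partner a = a, f a := by
  have h1 : ∑ x ∈ X.pairs, f (Sum.inl x.1) =
      ∑ a ∈ X.pairs.image (fun x => (Sum.inl x.1 : Agent C P)), f a := by
    rw [Finset.sum_image]
    rintro ⟨c, p⟩ hx ⟨c', p'⟩ hy h
    simp only [Sum.inl.injEq] at h
    subst h
    rw [X.provider_unique c p p' hx hy]
  have h2 : ∑ x ∈ X.pairs, f (Sum.inr x.2) =
      ∑ a ∈ X.pairs.image (fun x => (Sum.inr x.2 : Agent C P)), f a := by
    rw [Finset.sum_image]
    rintro ⟨c, p⟩ hx ⟨c', p'⟩ hy h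
    simp only [Sum.inr.injEq] at h
    subst h
    rw [X.customer_unique c c' p hx hy]
  rw [Finset.sum_add_distrib, h1, h2, ← Finset.sum_union,
    ← Finset.sum_filter_not_add_sum_filter S (fun a => X.partner a = a)]
  · congr 2
    ext a
    rcases a with c | p
    · simp only [Finset.mem_filter, Finset.mem_union, Finset.mem_image, Prod.exists, Sum.inl.injEq,
        reduceCtorEq, and_false, exists_false, or_false]
      rw [← ne_eq, X.partner_inl_ne]
      constructor
      · rintro ⟨-, p, hp⟩; exact ⟨c, p, hp, rfl⟩
      · rintro ⟨c, p, hp, rfl⟩; exact ⟨(hS c p hp).1, p, hp⟩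
    · simp only [Finset.mem_filter, Finset.mem_union, Finset.mem_image, Prod.exists, Sum.inr.injEq,
        reduceCtorEq, and_false, exists_false, false_or]
      rw [← ne_eq, X.partner_inr_ne]
      constructor
      · rintro ⟨-, c, hp⟩; exact ⟨c, p, hp, rfl⟩
      · rintro ⟨c, p, hp, rfl⟩; exact ⟨(hS c p hp).2, c, hp⟩
  · rw [Finset.disjoint_left]
    intro a ha hb
    simp only [Finset.mem_image] at ha hb
    obtain ⟨x, -, rfl⟩ := ha
    obtain ⟨y, -, h⟩ := hb
    cases h

variable [Fintype C] [Fintype P]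

lemma Matching.within_univ (X : Matching C P) : X.Within Finset.univ :=
  fun _ _ _ => ⟨Finset.mem_univ _, Finset.mem_univ _⟩

lemma weight_eq_sum_pairs {v : Agent C P → Agent C P → ℝ} (hv : ∀ a, v a a = 0)
    (X : Matching C P) :
    weight v X = ∑ x ∈ X.pairs,
      (v (Sum.inl x.1) (Sum.inr x.2) + v (Sum.inr x.2) (Sum.inl x.1)) := by
  classical
  rw [weight, X.sum_eq_sum_pairs_add X.within_univ, Finset.sum_eq_zero (s := Finset.filter _ _),
    add_zero]
  · refine Finset.sum_congr rfl fun x hx => ?_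
    rw [(X.partner_inl_eq_inr x.1 x.2).2 hx, (X.partner_inr_eq_inl x.1 x.2).2 hx]
  · intro a ha
    rw [(Finset.mem_filter.1 ha).2, hv]

end Matchings

/-! ### Strong duality and complementary slackness for the assignment problem -/

section Duality

variable {C P : Type*}

/-- The joint utility of a customer (as a row) and a provider (as a column), in the square matrix
which is padded by zeros. -/
def paddedWeight (v : Agent C P → Agent C P → ℝ) : Agent C P → Agent C P → ℝ
  | Sum.inl c, Sum.inr q => v (Sum.inl c) (Sum.inr q) + v (Sum.inr q) (Sum.inl c)
  | _, _ => 0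

/-- A positive lower bound on the positive values of a function on a finite type. -/
lemma exists_pos_le_of_pos {ι : Type*} [Finite ι] (s : ι → ℝ) :
    ∃ r > 0, ∀ i, 0 < s i → r ≤ s i := by
  -- The extra element 1 serves the case in which `s` has no positive value.
  have hfin : (insert 1 {x | 0 < x ∧ ∃ i, s i = x} : Set ℝ).Finite := by
    refine Set.Finite.insert _ ((Set.finite_range s).subset ?_)
    rintro x ⟨-, i, rfl⟩
    exact ⟨i, rfl⟩
  obtain ⟨r, hr, hmin⟩ := hfin.exists_minimalFor id _ ⟨1, Set.mem_insert _ _⟩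
  refine ⟨r, ?_, fun i hi => ?_⟩
  · rcases hr with rfl | hr
    · exact one_pos
    · exact hr.1
  · by_contra! h
    exact absurd (hmin (Or.inr ⟨hi, i, rfl⟩) h.le) (not_le.2 h)

variable [Fintype C] [Fintype P] [Nonempty C] [Nonempty P]

/-- Row and column potentials of the padded matrix yield dual prices of at most the same total. -/
lemma exists_isDualFeasible_of_potentials {v : Agent C P → Agent C P → ℝ} {f g : Agent C P → ℝ}
    (h : ∀ i j, paddedWeight v i j ≤ f i + g j) :
    ∃ q, IsDualFeasible v q ∧ ∑ a, q a ≤ ∑ a, f a + ∑ a, g a := by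
  obtain ⟨c₀, hc₀⟩ := Finite.exists_min (fun c : C => g (Sum.inl c))
  obtain ⟨q₀, hq₀⟩ := Finite.exists_min (fun q : P => f (Sum.inr q))
  -- Columns `Sum.inl c` and rows `Sum.inr q` are dummies with zero entries. Adding the least dummy
  -- potential makes the prices nonnegative. The total does not grow, because there are as many
  -- dummy columns as customers and as many dummy rows as providers.
  refine ⟨Sum.elim (fun c => f (Sum.inl c) + g (Sum.inl c₀)) (fun q => g (Sum.inr q) +
    f (Sum.inr q₀)), ⟨fun c q => ?_, ?_⟩, ?_⟩
  · have h1 := h (Sum.inl c) (Sum.inr q)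
    have h2 := h (Sum.inr q₀) (Sum.inl c₀)
    simp only [paddedWeight] at h1 h2
    simp only [Sum.elim_inl, Sum.elim_inr]
    linarith
  · rintro (c | q)
    · exact h (Sum.inl c) (Sum.inl c₀)
    · have := h (Sum.inr q₀) (Sum.inr q)
      simp only [paddedWeight] at this
      simp only [Sum.elim_inr]
      linarith
  · simp only [Fintype.sum_sum_type, Sum.elim_inl, Sum.elim_inr, Finset.sum_add_distrib]
    have h1 := Finset.sum_le_sum fun c (_ : c ∈ Finset.univ) => hc₀ c
    have h2 := Finset.sum_le_sum fun q (_ : q ∈ Finset.univ) => hq₀ q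
    linarith

/-- Strong duality for the assignment problem: some matching attains the value of the dual. -/
lemma IsOptimalDual.exists_matching {v : Agent C P → Agent C P → ℝ} (hv : ∀ a, v a a = 0)
    {p : Agent C P → ℝ} (hp : IsOptimalDual v p) : ∃ Y : Matching C P, ∑ a, p a = weight v Y := by
  classical
  set f : Agent C P → ℝ := Sum.elim (fun c => p (Sum.inl c)) (fun _ => 0) with hf
  set g : Agent C P → ℝ := Sum.elim (fun _ => 0) (fun q => p (Sum.inr q)) with hg
  have hfg : ∑ a, f a + ∑ a, g a = ∑ a, p a := by
    simp [Fintype.sum_sum_type, hf, hg]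
  have hfeas : ∀ i j, paddedWeight v i j ≤ f i + g j := by
    rintro (c | q) (c' | q')
    · simpa [paddedWeight, hf, hg] using hp.1.2 _
    · simpa [paddedWeight, hf, hg] using hp.1.1 c q'
    · simp [paddedWeight, hf, hg]
    · simpa [paddedWeight, hf, hg] using hp.1.2 _
  let tight : Agent C P → Finset (Agent C P) := fun i => {j | f i + g j = paddedWeight v i j}
  -- Were Hall's condition to fail at `S`, lowering the potentials of `S` and raising those of its
  -- tight neighbours by the least positive slack `r` would keep feasibility and strictly decrease
  -- the total, against optimality.
  have hall : ∀ S : Finset (Agent C P), S.card ≤ (S.biUnion tight).card := by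
    intro S
    by_contra! hlt
    obtain ⟨r, hr, hmin⟩ := exists_pos_le_of_pos
      (fun x : Agent C P × Agent C P => f x.1 + g x.2 - paddedWeight v x.1 x.2)
    set f' : Agent C P → ℝ := fun i => f i - if i ∈ S then r else 0 with hf'
    set g' : Agent C P → ℝ := fun j => g j + if j ∈ S.biUnion tight then r else 0 with hg'
    obtain ⟨q, hq, hsum⟩ := exists_isDualFeasible_of_potentials (v := v) (f := f') (g := g') (by
      intro i j
      have h0 := hfeas i j
      simp only [hf', hg']
      by_cases hi : i ∈ S
      · by_cases hj : j ∈ S.biUnion tight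
        · simp only [hi, hj, if_true]; linarith
        · have hne : f i + g j ≠ paddedWeight v i j := by
            intro h
            exact hj (Finset.mem_biUnion.2 ⟨i, hi, by simpa [tight] using h⟩)
          have := hmin (i, j) (sub_pos.2 (lt_of_le_of_ne h0 hne.symm))
          simp only [hi, hj, if_true, if_false]
          linarith
      · simp only [hi, if_false]
        split_ifs <;> linarith)
    have hopt := hp.2 q hq
    have e1 : ∑ a, f' a = ∑ a, f a - S.card * r := by
      simp [hf', Finset.sum_sub_distrib, Finset.sum_ite_mem]
    have e2 : ∑ a, g' a = ∑ a, g a + (S.biUnion tight).card * r := by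
      simp only [hg', Finset.sum_add_distrib, Finset.sum_ite_mem, Finset.univ_inter,
        Finset.sum_const, nsmul_eq_mul]
    have hlt' : ((S.biUnion tight).card : ℝ) < S.card := by exact_mod_cast hlt
    have := mul_lt_mul_of_pos_right hlt' hr
    linarith
  obtain ⟨σ, hσ, hmem⟩ := (Finset.all_card_le_biUnion_card_iff_exists_injective tight).1 hall
  -- The permutation `σ` uses tight entries only, so its entries sum to the dual value; those that
  -- are not customer-provider entries are zero and can be dropped.
  let Y : Matching C P :=
    { pairs := {x | σ (Sum.inl x.1) = Sum.inr x.2}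
      provider_unique := by
        intro c q q' h h'
        simp only [Finset.mem_filter, Finset.mem_univ, true_and] at h h'
        exact Sum.inr_injective (h.symm.trans h')
      customer_unique := by
        intro c c' q h h'
        simp only [Finset.mem_filter, Finset.mem_univ, true_and] at h h'
        exact Sum.inl_injective (hσ (h.trans h'.symm)) }
  refine ⟨Y, ?_⟩
  have hbij : Function.Bijective σ := Finite.injective_iff_bijective.1 hσ
  have hg2 : ∑ a, g (σ a) = ∑ a, g a := hbij.sum_comp g
  rw [← hfg, ← hg2, ← Finset.sum_add_distrib, weight_eq_sum_pairs hv]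
  have h1 : ∀ a, f a + g (σ a) = paddedWeight v a (σ a) := by
    intro a
    simpa [tight] using hmem a
  rw [Finset.sum_congr rfl fun a _ => h1 a, Fintype.sum_sum_type]
  have h2 : ∀ q : P, paddedWeight v (Sum.inr q) (σ (Sum.inr q)) = 0 := fun q => rfl
  simp only [h2, Finset.sum_const_zero, add_zero, Y]
  rw [Finset.sum_filter, Fintype.sum_prod_type]
  refine Finset.sum_congr rfl fun c _ => ?_
  rcases hc : σ (Sum.inl c) with c' | q
  · simp [paddedWeight, hc]
  · simp [paddedWeight, hc]

/-- Complementary slackness: the agents which a maximum weight matching leaves unmatched have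
price zero. -/
lemma IsOptimalDual.eq_zero_of_unmatched {v : Agent C P → Agent C P → ℝ} (hv : ∀ a, v a a = 0)
    {p : Agent C P → ℝ} (hp : IsOptimalDual v p) {X : Matching C P} (hX : IsMaxWeight v X)
    {a : Agent C P} (ha : X.partner a = a) : p a = 0 := by
  classical
  obtain ⟨Y, hY⟩ := hp.exists_matching hv
  have h1 := hX Y
  rw [← hY, X.sum_eq_sum_pairs_add X.within_univ, weight_eq_sum_pairs hv] at h1
  -- The prices of the matched pairs alone already sum to at least the weight of `X`, which leaves
  -- nothing for the unmatched agents.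
  have h2 := Finset.sum_le_sum fun x (_ : x ∈ X.pairs) => hp.1.1 x.1 x.2
  have h3 : p a ≤ ∑ b with X.partner b = b, p b :=
    Finset.single_le_sum (fun b _ => hp.1.2 b) (Finset.mem_filter.2 ⟨Finset.mem_univ a, ha⟩)
  have := hp.1.2 a
  linarith

end Duality

/-! ### Bounds on Subset Instability -/

section Instability

variable {C P : Type*} {u : Agent C P → Agent C P → ℝ} {X : Matching C P} {τ : Agent C P → ℝ}

instance : Nonempty (Matching C P) := ⟨⟨∅, by simp, by simp⟩⟩

instance (S : Finset (Agent C P)) : Nonempty {Y : Matching C P // Y.Within S} :=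
  ⟨⟨⟨∅, by simp, by simp⟩, fun _ _ h => by simp at h⟩⟩

lemma instability_nonneg [Finite C] [Finite P] : 0 ≤ instability u X τ := by
  have h := le_ciSup (Set.finite_range fun S : Finset (Agent C P) =>
    ((⨆ Y : {Y : Matching C P // Y.Within S}, ∑ a ∈ S, u a (Y.1.partner a)) -
      ∑ a ∈ S, (u a (X.partner a) + τ a))).bddAbove ∅
  refine le_trans ?_ h
  simp

/-- To bound the instability one bounds the deficit of every matching within every coalition. -/
lemma instability_le {r : ℝ} (h : ∀ (S : Finset (Agent C P)) (Y : Matching C P), Y.Within S →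
    ∑ a ∈ S, u a (Y.partner a) ≤ ∑ a ∈ S, (u a (X.partner a) + τ a) + r) :
    instability u X τ ≤ r := by
  refine ciSup_le fun S => ?_
  rw [sub_le_iff_le_add']
  exact ciSup_le fun Y => h S Y.1 Y.2

/-- Split a coalition along a competing matching: its pairs do not block, and its unmatched members
are covered by individual rationality. -/
lemma IsStable.instability_le_zero (hu : ∀ a, u a a = 0) (h : IsStable u X τ) :
    instability u X τ ≤ 0 := by
  classical
  refine instability_le fun S Y hY => ?_
  rw [add_zero, Y.sum_eq_sum_pairs_add hY, Y.sum_eq_sum_pairs_add hY]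
  refine add_le_add (Finset.sum_le_sum fun x hx => ?_) (Finset.sum_le_sum fun a ha => ?_)
  · rw [(Y.partner_inl_eq_inr x.1 x.2).2 hx, (Y.partner_inr_eq_inl x.1 x.2).2 hx]
    exact h.2 x.1 x.2
  · rw [(Finset.mem_filter.1 ha).2, hu]
    exact h.1 a

lemma instability_le_four_mul_card [Fintype C] [Fintype P] (hu : IsUnstructured u)
    (h : ∀ a, -3 ≤ u a (X.partner a) + τ a) :
    instability u X τ ≤ 4 * Fintype.card (Agent C P) := by
  refine instability_le fun S Y _ => ?_
  have h1 := Finset.sum_le_card_nsmul S (fun a => u a (Y.partner a)) 1 fun a _ => (hu.1 a _).2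
  have h2 := Finset.card_nsmul_le_sum S (fun a => u a (X.partner a) + τ a) (-3) fun a _ => h a
  have h3 : (S.card : ℝ) ≤ Fintype.card (Agent C P) := by exact_mod_cast S.card_le_univ
  simp only [nsmul_eq_mul] at h1 h2
  linarith

end Instability

/-! ### The gap of a matching -/

section Gap

variable {C P : Type*}

lemma IsUnstructured.self_eq_zero {u : Agent C P → Agent C P → ℝ} (hu : IsUnstructured u)
    (a : Agent C P) : u a a = 0 :=
  hu.2 a a (by simp [OppositeSides])

lemma Matching.exists_ne [Nonempty C] [Nonempty P] (X : Matching C P) : ∃ Y, Y ≠ X := by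
  obtain ⟨c⟩ := ‹Nonempty C›
  obtain ⟨p⟩ := ‹Nonempty P›
  by_contra! h
  have h1 := h ⟨∅, by simp, by simp⟩
  have h2 := h ⟨{(c, p)}, by simp +contextual, by simp +contextual⟩
  have := congrArg Matching.pairs (h1.trans h2.symm)
  simp at this

variable [Fintype C] [Fintype P]

lemma gap_le (u : Agent C P → Agent C P → ℝ) {X Y : Matching C P} (h : Y ≠ X) :
    gap u X ≤ weight u X - weight u Y :=
  ciInf_le (f := fun Y : {Y : Matching C P // Y ≠ X} => weight u X - weight u Y.1)
    (Set.finite_range _).bddBelow ⟨Y, h⟩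

lemma IsMaxWeight.gap_nonneg {u : Agent C P → Agent C P → ℝ} {X : Matching C P}
    (h : IsMaxWeight u X) : 0 ≤ gap u X :=
  Real.iInf_nonneg fun Y => sub_nonneg.2 (h Y.1)

lemma le_gap [Nonempty C] [Nonempty P] {u : Agent C P → Agent C P → ℝ} {X : Matching C P} {r : ℝ}
    (h : ∀ Y ≠ X, r ≤ weight u X - weight u Y) : r ≤ gap u X := by
  obtain ⟨Y, hY⟩ := X.exists_ne
  have : Nonempty {Y : Matching C P // Y ≠ X} := ⟨⟨Y, hY⟩⟩
  exact le_ciInf fun Y => h Y.1 Y.2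

/-- This bounds the rate from below, so that lower-order terms can be absorbed into it at the end.
-/
lemma gap_le_two_mul_card [Nonempty C] [Nonempty P] {u : Agent C P → Agent C P → ℝ}
    (hu : IsUnstructured u) (X : Matching C P) :
    gap u X ≤ 2 * Fintype.card (Agent C P) := by
  obtain ⟨Y, hY⟩ := X.exists_ne
  have h1 := Finset.sum_le_card_nsmul Finset.univ (fun a => u a (X.partner a)) 1
    fun a _ => (hu.1 a _).2
  have h2 := Finset.card_nsmul_le_sum Finset.univ (fun a => u a (Y.partner a)) (-1)
    fun a _ => (hu.1 a _).1
  have h3 := gap_le u hY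
  simp only [nsmul_eq_mul, Finset.card_univ] at h1 h2
  simp only [weight] at h3
  linarith

end Gap

/-! ### Deterministic analysis of one round -/

section ConfidenceSets

variable {C P : Type*}

/-- Confidence intervals in `[-1, 1]`, for the known utility zero of pairs on the same side. -/
structure IsConfSets (I : ConfSets C P) : Prop where
  neg_one_le : ∀ a b, -1 ≤ (I a b).1
  le_one : ∀ a b, (I a b).2 ≤ 1
  fst_le_snd : ∀ a b, (I a b).1 ≤ (I a b).2
  eq_zero : ∀ a b, ¬ OppositeSides a b → I a b = (0, 0)

/-- The confidence intervals contain the true utilities. -/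
def Covers (I : ConfSets C P) (u : Agent C P → Agent C P → ℝ) : Prop :=
  ∀ a b, (I a b).1 ≤ u a b ∧ u a b ≤ (I a b).2

/-- The width of the confidence intervals. -/
def width (I : ConfSets C P) : Agent C P → Agent C P → ℝ := fun a b => (I a b).2 - (I a b).1

lemma ucb_expand (I : ConfSets C P) (a b : Agent C P) :
    ucb (expand I) a b = ucb I a b + width I a b / 2 := rfl

variable {I : ConfSets C P}

lemma IsConfSets.ucb_self (hI : IsConfSets I) (a : Agent C P) : ucb I a a = 0 := by
  simp [ucb, hI.eq_zero a a (by simp [OppositeSides])]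

lemma IsConfSets.width_self (hI : IsConfSets I) (a : Agent C P) : width I a a = 0 := by
  simp [width, hI.eq_zero a a (by simp [OppositeSides])]

lemma IsConfSets.width_nonneg (hI : IsConfSets I) (a b : Agent C P) : 0 ≤ width I a b :=
  sub_nonneg.2 (hI.fst_le_snd a b)

lemma lowerOn_le (v : Agent C P → Agent C P → ℝ) (X : Matching C P) {δ : ℝ} (hδ : 0 ≤ δ)
    (a b : Agent C P) : lowerOn v X δ a b ≤ v a b := by
  unfold lowerOn
  split_ifs <;> linarith

lemma lowerOn_self (v : Agent C P → Agent C P → ℝ) (X : Matching C P) (δ : ℝ)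
    (a : Agent C P) : lowerOn v X δ a a = v a a := by
  simp [lowerOn]

lemma sub_le_lowerOn (v : Agent C P → Agent C P → ℝ) (X : Matching C P) {δ : ℝ} (hδ : 0 ≤ δ)
    (a b : Agent C P) : v a b - δ ≤ lowerOn v X δ a b := by
  unfold lowerOn
  split_ifs <;> linarith

variable [Fintype C] [Fintype P] {u : Agent C P → Agent C P → ℝ}

lemma weight_ucb_expand (I : ConfSets C P) (X : Matching C P) :
    weight (ucb (expand I)) X = weight (ucb I) X + weight (width I) X / 2 := by
  simp only [weight, ucb_expand, Finset.sum_add_distrib, Finset.sum_div]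

lemma IsConfSets.weight_width_nonneg (hI : IsConfSets I) (X : Matching C P) :
    0 ≤ weight (width I) X :=
  Finset.sum_nonneg fun a _ => hI.width_nonneg a _

lemma Covers.weight_le (h : Covers I u) (X : Matching C P) : weight u X ≤ weight (ucb I) X :=
  Finset.sum_le_sum fun a _ => (h a _).2

lemma Covers.weight_ucb_le (h : Covers I u) (X : Matching C P) :
    weight (ucb I) X ≤ weight u X + weight (width I) X := by
  rw [weight, weight, weight, ← Finset.sum_add_distrib]
  refine Finset.sum_le_sum fun a _ => ?_
  have := (h a (X.partner a)).1
  simp only [ucb, width]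
  linarith

lemma robustShift_nonneg {X : Matching C P} (hX : IsMaxWeight (ucb I) X) : 0 ≤ robustShift I X :=
  div_nonneg hX.gap_nonneg (Nat.cast_nonneg _)

/-- A maximum weight matching for the upper confidence bounds remains one if these bounds are
lowered on its pairs by `robustShift`. -/
lemma isMaxWeight_lowerOn [Nonempty C] {X : Matching C P} (hX : IsMaxWeight (ucb I) X) :
    IsMaxWeight (lowerOn (ucb I) X (robustShift I X)) X := by
  intro Y
  rcases eq_or_ne Y X with rfl | hY
  · exact le_rfl
  have hδ := robustShift_nonneg hX
  have h1 : weight (lowerOn (ucb I) X (robustShift I X)) Y ≤ weight (ucb I) Y :=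
    Finset.sum_le_sum fun a _ => lowerOn_le _ _ hδ _ _
  -- Each agent loses at most the gap divided by the number of agents, so `X` loses at most its
  -- lead.
  have h2 : weight (ucb I) X - gap (ucb I) X ≤
      weight (lowerOn (ucb I) X (robustShift I X)) X := by
    have h3 := Finset.sum_le_sum fun a (_ : a ∈ Finset.univ) =>
      sub_le_lowerOn (ucb I) X hδ a (X.partner a)
    rw [Finset.sum_sub_distrib, Finset.sum_const, nsmul_eq_mul, Finset.card_univ, robustShift,
      mul_div_cancel₀ _ (Nat.cast_ne_zero.2 Fintype.card_ne_zero)] at h3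
    exact h3
  have := gap_le (ucb I) hY
  linarith

/-- No agent loses more than `3` in an output of the modified `ComputeMatch`. -/
lemma IsComputeMatchOutput.neg_three_le (hu : IsUnstructured u) (hI : IsConfSets I)
    {X : Matching C P} {τ : Agent C P → ℝ} (h : IsComputeMatchOutput I X τ) (a : Agent C P) :
    -3 ≤ u a (X.partner a) + τ a := by
  obtain ⟨X₁, p', X₂, p₂, hX₁, hp', -, hp₂, h⟩ := h
  have h0 := (hu.1 a (X.partner a)).1
  rcases h with ⟨-, rfl, rfl⟩ | ⟨-, rfl, rfl⟩
  -- An expanded upper bound is at most 1 + 2/2 = 2, and the true utility is at least -1.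
  · have h1 := hI.neg_one_le a (X.partner a)
    have h2 := hI.le_one a (X.partner a)
    have h3 := hp₂.1.2 a
    simp only [transfersOf, ucb, expand]
    split_ifs <;> linarith
  · have h2 := hI.le_one a (X.partner a)
    have h3 := hp'.1.2 a
    have h4 := robustShift_nonneg hX₁
    simp only [transfersOf, raiseOn, ucb]
    split_ifs <;> linarith

/-- If the confidence intervals cover the true utilities and those of the pairs of `X` are no wider
than `robustShift`, then the robust dual prices make `X` stable. -/
lemma isStable_of_width_le_robustShift [Nonempty C] [Nonempty P] (hu : IsUnstructured u)
    (hI : IsConfSets I) (hc : Covers I u) {X : Matching C P} (hX : IsMaxWeight (ucb I) X)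
    {p : Agent C P → ℝ} (hp : IsOptimalDual (lowerOn (ucb I) X (robustShift I X)) p)
    (hw : ∀ a, X.partner a ≠ a → width I a (X.partner a) ≤ robustShift I X) :
    IsStable u X (transfersOf (ucb I) X (raiseOn p X (robustShift I X))) := by
  set δ := robustShift I X with hδ
  have hδ0 : 0 ≤ δ := robustShift_nonneg hX
  have hzero : ∀ a, X.partner a = a → p a = 0 := fun a ha =>
    hp.eq_zero_of_unmatched (fun a => (lowerOn_self _ _ _ a).trans (hI.ucb_self a))
      (isMaxWeight_lowerOn hX) ha
  -- The raise by `δ` outweighs the overestimate of a matched agent's utility, which is at most the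
  -- width. Unmatched agents have net utility and price both zero.
  have hnet : ∀ a, p a ≤ u a (X.partner a) +
      transfersOf (ucb I) X (raiseOn p X δ) a := by
    intro a
    by_cases ha : X.partner a = a
    · simp [transfersOf, ha, hzero a ha, hu.self_eq_zero]
    · have h1 := hw a ha
      have h2 := (hc a (X.partner a)).1
      simp only [width] at h1
      simp only [transfersOf, raiseOn, ucb, ne_eq, ha, not_false_eq_true, if_true]
      linarith
  refine ⟨fun a => (hp.1.2 a).trans (hnet a), fun c q => ?_⟩
  have hf := hp.1.1 c q
  -- On a pair of `X` the two raises cancel the two reductions of the utilities. Any other pair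
  -- keeps its upper bounds, which dominate the true utilities.
  by_cases hq : (c, q) ∈ X.pairs
  · have h1 := (X.partner_inl_eq_inr c q).2 hq
    have h2 := (X.partner_inr_eq_inl c q).2 hq
    simp only [lowerOn, transfersOf, raiseOn, h1, h2, ne_eq, reduceCtorEq, not_false_eq_true,
      and_self, if_true] at hf ⊢
    linarith
  · have h1 := mt (X.partner_inl_eq_inr c q).1 hq
    have h2 := mt (X.partner_inr_eq_inl c q).1 hq
    simp only [lowerOn, h1, h2, false_and, if_false] at hf
    have h3 := (hc (Sum.inl c) (Sum.inr q)).2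
    have h4 := (hc (Sum.inr q) (Sum.inl c)).2
    have h5 := hnet (Sum.inl c)
    have h6 := hnet (Sum.inr q)
    simp only [ucb] at hf h5 h6 ⊢
    linarith

/-- If the confidence intervals cover the true utilities and those of the selected pairs are narrow,
then the output of the modified `ComputeMatch` is stable. -/
lemma IsComputeMatchOutput.isStable [Nonempty C] [Nonempty P] (hu : IsUnstructured u)
    {Xopt : Matching C P} (hgap : 0 < gap u Xopt)
    (hI : IsConfSets I) (hc : Covers I u) {X : Matching C P} {τ : Agent C P → ℝ}
    (h : IsComputeMatchOutput I X τ)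
    (hw : ∀ a, X.partner a ≠ a →
      width I a (X.partner a) ≤ gap u Xopt / (16 * Fintype.card (Agent C P))) :
    IsStable u X τ := by
  obtain ⟨X₁, p', X₂, p₂, hX₁, hp', hX₂, -, h⟩ := h
  set Δ := gap u Xopt with hΔ
  have hN : (0 : ℝ) < Fintype.card (Agent C P) := Nat.cast_pos.2 Fintype.card_pos
  have hX : X = X₂ := by
    rcases h with ⟨-, h, -⟩ | ⟨h, h', -⟩
    · exact h
    · exact h'.trans h
  have hS : weight (width I) X ≤ Δ / 16 := by
    have h1 := Finset.sum_le_card_nsmul Finset.univ (fun a => width I a (X.partner a))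
      (Δ / (16 * Fintype.card (Agent C P))) (fun a _ => by
        by_cases ha : X.partner a = a
        · rw [ha, hI.width_self]; positivity
        · exact hw a ha)
    rw [nsmul_eq_mul, Finset.card_univ] at h1
    have e : (Fintype.card (Agent C P) : ℝ) * (Δ / (16 * Fintype.card (Agent C P))) = Δ / 16 := by
      field_simp
    rw [e] at h1
    exact h1
  -- The error 3/2 is one width from passing from the upper bounds to `u` on `X`, and half a width
  -- from the expansion.
  have hmax : ∀ Y, weight (ucb I) Y + weight (width I) Y / 2 ≤ weight u X + 3 / 2 * (Δ / 16) := by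
    intro Y
    have h1 := hX₂ Y
    rw [weight_ucb_expand, weight_ucb_expand, ← hX] at h1
    have h2 := hc.weight_ucb_le X
    linarith
  have hopt : X = Xopt := by
    by_contra hne
    have h1 := hmax Xopt
    have h2 := gap_le u hne
    have h3 := hc.weight_le Xopt
    have h4 := hI.weight_width_nonneg Xopt
    linarith
  subst hopt
  rcases h with ⟨hne, -, -⟩ | ⟨-, rfl, rfl⟩
  -- If `X₁` differed from `X`, its upper bound could reach that of `X` only with total width at
  -- least `Δ`; the bonus of half that width would then violate `hmax`.
  · exfalso
    rw [← hX] at hne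
    have h1 := hmax X₁
    have h2 := gap_le u hne
    have h3 := hX₁ X
    have h4 := hc.weight_le X
    have h5 := hc.weight_ucb_le X₁
    linarith
  · refine isStable_of_width_le_robustShift hu hI hc hX₁ hp' fun a ha => (hw a ha).trans ?_
    -- With g the lead of `X` over `Y` and w the total width of `Y`, both g ≥ w/2 - Δ/32 and g ≥ Δ -
    -- w hold; eliminating w gives g ≥ 5Δ/16.
    have hg : Δ / 16 ≤ gap (ucb I) X := by
      refine le_gap fun Y hY => ?_
      have h1 := hX₂ Y
      rw [weight_ucb_expand, weight_ucb_expand, ← hX] at h1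
      have h2 := gap_le u hY
      have h3 := hc.weight_le X
      have h4 := hc.weight_ucb_le Y
      linarith
    rw [robustShift, ← div_div]
    exact div_le_div_of_nonneg_right hg hN.le

end ConfidenceSets

/-! ### Concentration of noise observed at predictable times -/

section AdaptiveSum

variable {Ω : Type*} {mΩ : MeasurableSpace Ω} {μ : Measure Ω}

lemma lintegral_exp_le_one_of_hasSubgaussianMGF {ξ : Ω → ℝ} (h : HasSubgaussianMGF ξ 1 μ) (l : ℝ) :
    ∫⁻ ω, ENNReal.ofReal (Real.exp (l * ξ ω - l ^ 2 / 2)) ∂μ ≤ 1 := by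
  have hint : Integrable (fun ω => Real.exp (l * ξ ω - l ^ 2 / 2)) μ := by
    simp only [Real.exp_sub]
    exact (h.integrable_exp_mul l).div_const _
  rw [← ofReal_integral_eq_lintegral_ofReal hint (ae_of_all _ fun _ => (Real.exp_pos _).le),
    ENNReal.ofReal_le_one]
  simp only [Real.exp_sub, integral_div]
  rw [div_le_one (Real.exp_pos _)]
  simpa [mgf] using h.mgf_le l

variable [IsProbabilityMeasure μ] {m : ℕ → MeasurableSpace Ω} {ξ : ℕ → Ω → ℝ} {A : ℕ → Set Ω}
  {T : ℕ}

open Classical in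
/-- The exponential supermartingale of noise which is observed at predictable times. -/
lemma lintegral_prod_exp_le_one (hm : ∀ t, m t ≤ mΩ) (hmono : Monotone m)
    (hξ : ∀ t, Measurable[m (t + 1)] (ξ t))
    (hind : ∀ t, Indep (m t) (MeasurableSpace.comap (ξ t) inferInstance) μ)
    (hsub : ∀ t, HasSubgaussianMGF (ξ t) 1 μ) (hA : ∀ t < T, MeasurableSet[m t] (A t)) (l : ℝ)
    (t : ℕ) (ht : t ≤ T) :
    Measurable[m t] (fun ω => ∏ s ∈ Finset.range t,
        if ω ∈ A s then ENNReal.ofReal (Real.exp (l * ξ s ω - l ^ 2 / 2)) else 1) ∧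
      ∫⁻ ω, ∏ s ∈ Finset.range t,
        (if ω ∈ A s then ENNReal.ofReal (Real.exp (l * ξ s ω - l ^ 2 / 2)) else 1) ∂μ ≤ 1 := by
  induction t with
  | zero => simp
  | succ t ih =>
    obtain ⟨hmeas, hle⟩ := ih (Nat.le_of_succ_le ht)
    set M : Ω → ENNReal := fun ω => ∏ s ∈ Finset.range t,
      if ω ∈ A s then ENNReal.ofReal (Real.exp (l * ξ s ω - l ^ 2 / 2)) else 1 with hM
    set G : Ω → ENNReal := fun ω => ENNReal.ofReal (Real.exp (l * ξ t ω - l ^ 2 / 2)) with hG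
    have hAt := hA t ht
    have hGc : Measurable[MeasurableSpace.comap (ξ t) inferInstance] G := by
      have : Measurable fun x : ℝ => ENNReal.ofReal (Real.exp (l * x - l ^ 2 / 2)) := by fun_prop
      exact this.comp (comap_measurable (ξ t))
    have hξc : MeasurableSpace.comap (ξ t) inferInstance ≤ m (t + 1) := (hξ t).comap_le
    have hmt : m t ≤ m (t + 1) := hmono t.le_succ
    -- On `A t` the product gains a factor that is independent of the past and has mean at most 1;
    -- off `A t` it does not change.
    have hsplit : ∀ ω, (∏ s ∈ Finset.range (t + 1),
        if ω ∈ A s then ENNReal.ofReal (Real.exp (l * ξ s ω - l ^ 2 / 2)) else 1) =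
        (A t).indicator M ω * G ω + (A t)ᶜ.indicator M ω := by
      intro ω
      rw [Finset.prod_range_succ]
      by_cases h : ω ∈ A t <;> simp [h, hM, hG]
    have hM1 : Measurable[m t] ((A t).indicator M) := hmeas.indicator hAt
    have hM2 : Measurable[m t] ((A t)ᶜ.indicator M) := hmeas.indicator hAt.compl
    have hGm : Measurable[m (t + 1)] G := hGc.mono hξc le_rfl
    refine ⟨?_, ?_⟩
    · simp only [hsplit]
      exact ((hM1.mono hmt le_rfl).mul hGm).add (hM2.mono hmt le_rfl)
    · simp only [hsplit]
      rw [lintegral_add_right _ (hM2.mono (hm t) le_rfl),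
        lintegral_mul_eq_lintegral_mul_lintegral_of_independent_measurableSpace (hm t)
          (hξc.trans (hm _)) (hind t) hM1 hGc]
      calc _ ≤ (∫⁻ ω, (A t).indicator M ω ∂μ) * 1 + ∫⁻ ω, (A t)ᶜ.indicator M ω ∂μ := by
            gcongr
            exact lintegral_exp_le_one_of_hasSubgaussianMGF (hsub t) l
        _ = ∫⁻ ω, M ω ∂μ := by
            rw [mul_one, lintegral_indicator (hm t _ hAt), lintegral_indicator (hm t _ hAt).compl,
              lintegral_add_compl _ (hm t _ hAt)]
        _ ≤ 1 := hle

open Classical in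
/-- Tail bound for the sum of `n` noise variables which are observed at predictable times. -/
lemma measure_card_eq_and_lt_abs_sum_le (hm : ∀ t, m t ≤ mΩ) (hmono : Monotone m)
    (hξ : ∀ t, Measurable[m (t + 1)] (ξ t))
    (hind : ∀ t, Indep (m t) (MeasurableSpace.comap (ξ t) inferInstance) μ)
    (hsub : ∀ t, HasSubgaussianMGF (ξ t) 1 μ) (hA : ∀ t < T, MeasurableSet[m t] (A t))
    (t : ℕ) (ht : t ≤ T) (n : ℕ) {r : ℝ} (hr : 0 ≤ r) :
    μ {ω | ((Finset.range t).filter (fun s => ω ∈ A s)).card = n ∧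
        r * n < |∑ s ∈ (Finset.range t).filter (fun s => ω ∈ A s), ξ s ω|} ≤
      2 * ENNReal.ofReal (Real.exp (-(r ^ 2 * n / 2))) := by
  -- Markov's inequality for the supermartingale, with l = r and l = -r for the two tails. Fixing
  -- the count at `n` makes the compensator deterministic.
  have key : ∀ l : ℝ, l ^ 2 = r ^ 2 →
      μ {ω | ((Finset.range t).filter (fun s => ω ∈ A s)).card = n ∧
        r ^ 2 * n ≤ l * ∑ s ∈ (Finset.range t).filter (fun s => ω ∈ A s), ξ s ω} ≤
      ENNReal.ofReal (Real.exp (-(r ^ 2 * n / 2))) := by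
    intro l hl
    obtain ⟨hmeas, hle⟩ := lintegral_prod_exp_le_one hm hmono hξ hind hsub hA l t ht
    have h1 := meas_ge_le_lintegral_div (μ := μ) (hmeas.mono (hm t) le_rfl).aemeasurable
      (ε := ENNReal.ofReal (Real.exp (r ^ 2 * n / 2)))
      (by simpa using Real.exp_pos _) ENNReal.ofReal_ne_top
    refine (measure_mono ?_).trans (h1.trans ((ENNReal.div_le_div_right hle _).trans_eq ?_))
    · rintro ω ⟨hn, hω⟩
      rw [Set.mem_ofPred_eq, ← Finset.prod_filter,
        ← ENNReal.ofReal_prod_of_nonneg fun _ _ => (Real.exp_pos _).le, ← Real.exp_sum,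
        Finset.sum_sub_distrib, ← Finset.mul_sum, Finset.sum_const, hn, nsmul_eq_mul, hl]
      refine ENNReal.ofReal_le_ofReal (Real.exp_le_exp.2 ?_)
      linarith
    · rw [one_div, ← ENNReal.ofReal_inv_of_pos (Real.exp_pos _), Real.exp_neg]
  rw [two_mul]
  refine (measure_mono ?_).trans ((measure_union_le _ _).trans
    (add_le_add (key r rfl) (key (-r) (neg_sq r))))
  rintro ω ⟨hn, hω⟩
  rcases lt_abs.1 hω with h | h
  · left
    refine ⟨hn, ?_⟩
    have := mul_le_mul_of_nonneg_left h.le hr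
    linarith
  · right
    refine ⟨hn, ?_⟩
    have := mul_le_mul_of_nonneg_left h.le hr
    linarith

end AdaptiveSum

/-! ### The filtration of the noise -/

section Noise

variable {C P Ω : Type*}

lemma past_mono (ε : ℕ → Agent C P → Ω → ℝ) : Monotone (past ε) := fun _ _ hst =>
  biSup_mono fun _ hi => lt_of_lt_of_le hi hst

lemma measurable_past (ε : ℕ → Agent C P → Ω → ℝ) {s t : ℕ} (hst : s < t) (a : Agent C P) :
    Measurable[past ε t] (ε s a) := by
  refine Measurable.of_comap_le ?_
  exact (le_iSup (fun a => MeasurableSpace.comap (ε s a) inferInstance) a).trans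
    (le_iSup₂ (f := fun s (_ : s ∈ Set.Iio t) =>
      ⨆ a, MeasurableSpace.comap (ε s a) inferInstance) s hst)

variable [MeasurableSpace Ω] {μ : Measure Ω} {ε : ℕ → Agent C P → Ω → ℝ}

lemma IsNoise.past_le (h : IsNoise μ ε) (t : ℕ) : past ε t ≤ ‹MeasurableSpace Ω› :=
  iSup₂_le fun s _ => iSup_le fun a => (h.measurable s a).comap_le

lemma IsNoise.indep_past (h : IsNoise μ ε) (t : ℕ) (a : Agent C P) :
    Indep (past ε t) (MeasurableSpace.comap (ε t a) inferInstance) μ := by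
  have h1 := indep_iSup_of_disjoint (fun i => (h.measurable i.1 i.2).comap_le) h.indep.iIndep
    (S := {i : ℕ × Agent C P | i.1 < t}) (T := {(t, a)}) (by
      rw [Set.disjoint_singleton_right]; simp)
  refine indep_of_indep_of_le_left (indep_of_indep_of_le_right h1 ?_) ?_
  · simp
  · refine iSup₂_le fun s hs => iSup_le fun b => ?_
    exact le_iSup₂ (f := fun (i : ℕ × Agent C P) (_ : i ∈ {i : ℕ × Agent C P | i.1 < t}) =>
      MeasurableSpace.comap (ε i.1 i.2) inferInstance) (s, b) hs

end Noise

/-! ### Probability of the deviation event -/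

section Concentration

variable {C P Ω : Type*} [Fintype C] [Fintype P]

open Classical in
/-- In some round, the noise in the observations of some pair exceeds the confidence radius. -/
def deviationEvent (T : ℕ) (ε : ℕ → Agent C P → Ω → ℝ) (X : ℕ → Ω → Matching C P) : Set Ω :=
  {ω | ∃ t < T, ∃ a b, matchCount (fun s => X s ω) t a b ≠ 0 ∧
    radius (Fintype.card (Agent C P)) T (matchCount (fun s => X s ω) t a b) *
      matchCount (fun s => X s ω) t a b <
    |∑ s ∈ (Finset.range t).filter (fun s => (X s ω).partner a = b), ε s a ω|}

lemma card_agent_ge_two (C P : Type*) [Fintype C] [Fintype P] [Nonempty C] [Nonempty P] :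
    2 ≤ Fintype.card (Agent C P) := by
  rw [Fintype.card_sum]
  have := Fintype.card_pos (α := C)
  have := Fintype.card_pos (α := P)
  omega

lemma radius_sq_mul {N T n : ℕ} (hn : n ≠ 0) (hNT : 1 ≤ (N : ℝ) * T) :
    radius N T n ^ 2 * n = 64 * Real.log ((N : ℝ) * T) := by
  have hn' : (0 : ℝ) < n := Nat.cast_pos.2 (Nat.pos_of_ne_zero hn)
  rw [radius, mul_pow, Real.sq_sqrt (div_nonneg (Real.log_nonneg hNT) hn'.le)]
  field_simp
  ring

variable [MeasurableSpace Ω] {μ : Measure Ω} [IsProbabilityMeasure μ]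
  {ε : ℕ → Agent C P → Ω → ℝ} {X : ℕ → Ω → Matching C P} {T : ℕ}

/-- The number of observations is random and depends on the noise, so the union bound also runs over
its values, besides rounds and ordered pairs of agents. -/
lemma IsNoise.measure_deviationEvent_le [Nonempty C] [Nonempty P] (h : IsNoise μ ε) (hT : 1 ≤ T)
    (hX : ∀ t < T, Measurable[past ε t] (X t)) :
    μ (deviationEvent T ε X) ≤
      ENNReal.ofReal (1 / ((Fintype.card (Agent C P) : ℝ) ^ 2 * (T : ℝ) ^ 2)) := by
  classical
  set N := Fintype.card (Agent C P) with hN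
  have hN2 : (2 : ℝ) ≤ N := by exact_mod_cast card_agent_ge_two C P
  have hT1 : (1 : ℝ) ≤ T := by exact_mod_cast hT
  have hNT : (2 : ℝ) ≤ N * T := by nlinarith
  let E : Agent C P × Agent C P → ℕ → ℕ → Set Ω := fun x t n =>
    {ω | ((Finset.range t).filter (fun s => ω ∈ {ω | (X s ω).partner x.1 = x.2})).card = n ∧
        radius N T n * n <
          |∑ s ∈ (Finset.range t).filter (fun s => ω ∈ {ω | (X s ω).partner x.1 = x.2}),
            ε s x.1 ω|}
  have hsub : deviationEvent T ε X ⊆ ⋃ x ∈ (Finset.univ : Finset (Agent C P × Agent C P)),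
      ⋃ t ∈ Finset.range T, ⋃ n ∈ Finset.Icc 1 T, E x t n := by
    rintro ω ⟨t, ht, a, b, hn, hlt⟩
    simp only [Set.mem_iUnion]
    refine ⟨(a, b), Finset.mem_univ _, t, Finset.mem_range.2 ht,
      matchCount (fun s => X s ω) t a b, Finset.mem_Icc.2 ⟨Nat.pos_of_ne_zero hn, ?_⟩, ?_, hlt⟩
    · refine (Finset.card_filter_le _ _).trans ?_
      rw [Finset.card_range]; exact ht.le
    · rfl
  have hE : ∀ x, ∀ t ∈ Finset.range T, ∀ n ∈ Finset.Icc 1 T,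
      μ (E x t n) ≤ ENNReal.ofReal (2 * (((N : ℝ) * T) ^ 32)⁻¹) := by
    intro x t ht n hn
    have hA : ∀ s < T, MeasurableSet[past ε s] {ω | (X s ω).partner x.1 = x.2} := fun s hs => by
      have hpre : {ω | (X s ω).partner x.1 = x.2} = X s ⁻¹' {Y | Y.partner x.1 = x.2} := rfl
      rw [hpre]
      exact hX s hs MeasurableSpace.measurableSet_top
    have hb := measure_card_eq_and_lt_abs_sum_le (μ := μ) (m := past ε) (ξ := fun s => ε s x.1)
      (A := fun s => {ω | (X s ω).partner x.1 = x.2}) (T := T) h.past_le (past_mono ε)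
      (fun s => measurable_past ε s.lt_succ_self x.1) (fun s => h.indep_past s x.1)
      (fun s => h.subgaussian s x.1)
      hA
      t (Finset.mem_range.1 ht).le n (r := radius N T n) (by unfold radius; positivity)
    refine le_trans (le_of_eq ?_) (hb.trans_eq ?_)
    · simp only [E]
      congr!
    rw [radius_sq_mul (Nat.one_le_iff_ne_zero.1 (Finset.mem_Icc.1 hn).1) (by linarith),
      ENNReal.ofReal_mul (by norm_num), ENNReal.ofReal_ofNat]
    congr 2
    rw [Real.exp_neg, show 64 * Real.log ((N : ℝ) * T) / 2 = (32 : ℕ) * Real.log ((N : ℝ) * T) by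
      push_cast; ring, Real.exp_nat_mul, Real.exp_log (by linarith)]
  calc μ (deviationEvent T ε X)
      ≤ ∑ x : Agent C P × Agent C P, ∑ t ∈ Finset.range T, ∑ n ∈ Finset.Icc 1 T,
          ENNReal.ofReal (2 * (((N : ℝ) * T) ^ 32)⁻¹) := by
        refine (measure_mono hsub).trans ((measure_biUnion_finset_le _ _).trans ?_)
        refine Finset.sum_le_sum fun x _ => (measure_biUnion_finset_le _ _).trans ?_
        refine Finset.sum_le_sum fun t ht => (measure_biUnion_finset_le _ _).trans ?_
        exact Finset.sum_le_sum fun n hn => hE x t ht n hn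
    _ = ENNReal.ofReal ((N * N * (T * T) : ℕ) * (2 * (((N : ℝ) * T) ^ 32)⁻¹)) := by
        rw [ENNReal.ofReal_mul (Nat.cast_nonneg _), ENNReal.ofReal_natCast]
        simp only [Finset.sum_const, Finset.card_univ, Fintype.card_prod, Finset.card_range,
          Nat.card_Icc, nsmul_eq_mul, ← hN]
        push_cast
        ring
    _ ≤ _ := by
        refine ENNReal.ofReal_le_ofReal ?_
        push_cast
        have hpos : (0 : ℝ) < N * T := by linarith
        have e1 : (N : ℝ) * N * (T * T) = (N * T) ^ 2 := by ring
        have e2 : (N : ℝ) ^ 2 * T ^ 2 = (N * T) ^ 2 := by ring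
        rw [e1, e2]
        generalize (N : ℝ) * T = y at hpos hNT
        -- At most y² events of probability at most 2y⁻³² each, where y = NT ≥ 2, must fit into y⁻².
        have h28 : (2 : ℝ) ≤ y ^ 28 :=
          hNT.trans (le_self_pow₀ (by linarith) (by norm_num))
        rw [← mul_assoc, ← div_eq_mul_inv, div_le_div_iff₀ (by positivity) (by positivity)]
        calc y ^ 2 * 2 * y ^ 2 = 2 * y ^ 4 := by ring
          _ ≤ y ^ 28 * y ^ 4 := by gcongr
          _ = 1 * y ^ 32 := by ring

end Concentration

/-! ### Coverage and width of the confidence intervals -/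

section ConfidenceRadius

lemma clip_mono {x y : ℝ} (h : x ≤ y) : clip x ≤ clip y :=
  max_le_max le_rfl (min_le_min le_rfl h)

lemma neg_one_le_clip (x : ℝ) : -1 ≤ clip x := le_max_left _ _

lemma clip_le_one (x : ℝ) : clip x ≤ 1 := max_le (by norm_num) (min_le_left _ _)

lemma clip_of_mem {x : ℝ} (h : x ∈ Set.Icc (-1 : ℝ) 1) : clip x = x := by
  rw [clip, min_eq_right h.2, max_eq_right h.1]

lemma clip_sub_clip_le {x y : ℝ} (h : x ≤ y) : clip y - clip x ≤ y - x := by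
  unfold clip
  rcases le_total 1 x with h1 | h1 <;> rcases le_total 1 y with h2 | h2 <;>
    rcases le_total (-1) x with h3 | h3 <;> rcases le_total (-1) y with h4 | h4 <;>
    simp [*] <;> linarith

lemma radius_nonneg (N T n : ℕ) : 0 ≤ radius N T n := by
  unfold radius; positivity

variable {C P : Type*} [Fintype C] [Fintype P]

lemma isConfSets_confSets (T : ℕ) (X : ℕ → Matching C P) (y : ℕ → Agent C P → ℝ) (t : ℕ) :
    IsConfSets (confSets T X y t) := by
  refine ⟨fun a b => ?_, fun a b => ?_, fun a b => ?_, fun a b h => ?_⟩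
  · unfold confSets
    split_ifs <;> simp [neg_one_le_clip]
  · unfold confSets
    split_ifs <;> simp [clip_le_one]
  · unfold confSets
    split_ifs
    · norm_num
    · refine clip_mono ?_
      have := radius_nonneg (Fintype.card (Agent C P)) T (matchCount X t a b)
      linarith
    · exact le_rfl
  · simp [confSets, h]

lemma width_confSets_le (T : ℕ) (X : ℕ → Matching C P) (y : ℕ → Agent C P → ℝ) (t : ℕ)
    (a b : Agent C P) (h : matchCount X t a b ≠ 0) :
    width (confSets T X y t) a b ≤
      2 * radius (Fintype.card (Agent C P)) T (matchCount X t a b) := by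
  have hr := radius_nonneg (Fintype.card (Agent C P)) T (matchCount X t a b)
  unfold width confSets
  split_ifs
  · refine (clip_sub_clip_le (by linarith)).trans ?_
    linarith
  · simpa using hr

/-- Outside the deviation event, the confidence intervals of all rounds cover the true utilities. -/
lemma covers_confSets {Ω : Type*} {u : Agent C P → Agent C P → ℝ} (hu : IsUnstructured u) {T : ℕ}
    {ε : ℕ → Agent C P → Ω → ℝ} {X : ℕ → Ω → Matching C P} {ω : Ω}
    (hω : ω ∉ deviationEvent T ε X) {t : ℕ} (ht : t < T) :
    Covers (confSets T (fun s => X s ω) (feedback u ε X ω) t) u := by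
  classical
  intro a b
  have hub := hu.1 a b
  unfold confSets
  split_ifs with hab hn
  · exact hub
  · have hdev : |∑ s ∈ (Finset.range t).filter (fun s => (X s ω).partner a = b), ε s a ω| ≤
        radius (Fintype.card (Agent C P)) T (matchCount (fun s => X s ω) t a b) *
          matchCount (fun s => X s ω) t a b := by
      by_contra! hlt
      refine hω ⟨t, ht, a, b, hn, ?_⟩
      convert hlt
    set n := matchCount (fun s => X s ω) t a b with hn'
    have hpos : (0 : ℝ) < n := Nat.cast_pos.2 (Nat.pos_of_ne_zero hn)
    have hmean : empMean (fun s => X s ω) (feedback u ε X ω) t a b = u a b +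
        (∑ s ∈ (Finset.range t).filter (fun s => (X s ω).partner a = b), ε s a ω) / n := by
      have hsum : ∑ s ∈ (Finset.range t).filter (fun s => (X s ω).partner a = b),
          feedback u ε X ω s a = n * u a b +
          ∑ s ∈ (Finset.range t).filter (fun s => (X s ω).partner a = b), ε s a ω := by
        have hc : n = ((Finset.range t).filter (fun s => (X s ω).partner a = b)).card := by
          rw [hn', matchCount]
        rw [hc, ← nsmul_eq_mul, ← Finset.sum_const, ← Finset.sum_add_distrib]
        refine Finset.sum_congr rfl fun s hs => ?_
        rw [feedback, (Finset.mem_filter.1 hs).2]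
      have he : empMean (fun s => X s ω) (feedback u ε X ω) t a b =
          (∑ s ∈ (Finset.range t).filter (fun s => (X s ω).partner a = b),
            feedback u ε X ω s a) / n := by
        rw [empMean]
      rw [he, hsum, add_div, mul_div_cancel_left₀ _ hpos.ne']
    have habs : |(∑ s ∈ (Finset.range t).filter (fun s => (X s ω).partner a = b), ε s a ω) / n| ≤
        radius (Fintype.card (Agent C P)) T n := by
      rwa [abs_div, abs_of_pos hpos, div_le_iff₀ hpos]
    obtain ⟨h1, h2⟩ := abs_le.1 habs
    constructor
    · calc _ ≤ clip (u a b) := clip_mono (by rw [hmean]; linarith)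
        _ = u a b := clip_of_mem hub
    · calc u a b = clip (u a b) := (clip_of_mem hub).symm
        _ ≤ _ := clip_mono (by rw [hmean]; linarith)
  · simp [hu.2 a b hab]

end ConfidenceRadius

/-! ### Counting unstable rounds -/

section Counting

/-- A property holds at most `k + 1` times while it has held at most `k` times before. -/
lemma card_filter_count_le (q : ℕ → Prop) [DecidablePred q] (T : ℕ) {k : ℝ} (hk : 0 ≤ k) :
    (((Finset.range T).filter
      (fun t => q t ∧ (((Finset.range t).filter q).card : ℝ) ≤ k)).card : ℝ) ≤ k + 1 := by
  set F := (Finset.range T).filter (fun t => q t ∧ (((Finset.range t).filter q).card : ℝ) ≤ k)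
  rcases F.eq_empty_or_nonempty with h | h
  · rw [h, Finset.card_empty, Nat.cast_zero]; linarith
  · have hmem := F.max'_mem h
    -- At the last round of `F`, all other rounds of `F` are among the at most `k` earlier
    -- occurrences.
    have hsub : F.erase (F.max' h) ⊆ (Finset.range (F.max' h)).filter q := by
      intro s hs
      have hsF := Finset.mem_of_mem_erase hs
      rw [Finset.mem_filter, Finset.mem_range]
      exact ⟨lt_of_le_of_ne (F.le_max' s hsF) (Finset.ne_of_mem_erase hs),
        (Finset.mem_filter.1 hsF).2.1⟩
    have h1 : F.card ≤ ((Finset.range (F.max' h)).filter q).card + 1 := by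
      rw [← Finset.card_erase_add_one hmem]
      exact Nat.add_le_add_right (Finset.card_le_card hsub) 1
    have h2 : (F.card : ℝ) ≤ ((Finset.range (F.max' h)).filter q).card + 1 := by exact_mod_cast h1
    linarith [(Finset.mem_filter.1 hmem).2.2]

variable {C P Ω : Type*}

lemma unstableRounds_le_horizon (u : Agent C P → Agent C P → ℝ) (T : ℕ) (X : ℕ → Ω → Matching C P)
    (τ : ℕ → Ω → Agent C P → ℝ) (ω : Ω) : unstableRounds u T X τ ω ≤ T := by
  classical
  exact (Finset.card_filter_le _ _).trans_eq (Finset.card_range T)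

variable [Fintype C] [Fintype P]
  {u : Agent C P → Agent C P → ℝ} {T : ℕ} {ε : ℕ → Agent C P → Ω → ℝ} {X : ℕ → Ω → Matching C P}
  {τ : ℕ → Ω → Agent C P → ℝ}

lemma IsMatchUCBRun.instability_le (hu : IsUnstructured u) (h : IsMatchUCBRun u T ε X τ)
    {t : ℕ} (ht : t < T) (ω : Ω) :
    instability u (X t ω) (τ t ω) ≤ 4 * Fintype.card (Agent C P) :=
  instability_le_four_mul_card hu fun a =>
    (h.output t ht ω).neg_three_le hu (isConfSets_confSets _ _ _ _) a

lemma regret_nonneg (u : Agent C P → Agent C P → ℝ) (T : ℕ) (X : ℕ → Ω → Matching C P)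
    (τ : ℕ → Ω → Agent C P → ℝ) (ω : Ω) : 0 ≤ regret u T X τ ω :=
  Finset.sum_nonneg fun _ _ => instability_nonneg

open Classical in
lemma IsMatchUCBRun.regret_le (hu : IsUnstructured u) (h : IsMatchUCBRun u T ε X τ) (ω : Ω) :
    regret u T X τ ω ≤ 4 * Fintype.card (Agent C P) * unstableRounds u T X τ ω := by
  rw [unstableRounds, Finset.card_filter, Nat.cast_sum, Finset.mul_sum]
  refine Finset.sum_le_sum fun t ht => ?_
  by_cases hs : IsStable u (X t ω) (τ t ω)
  · simpa [hs] using hs.instability_le_zero hu.self_eq_zero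
  · simpa [hs] using h.instability_le hu (Finset.mem_range.1 ht) ω

variable [Nonempty C] [Nonempty P]

/-- In an unstable round outside the deviation event, a pair with few observations is selected. -/
lemma IsMatchUCBRun.exists_matchCount_le (hu : IsUnstructured u) {Xopt : Matching C P}
    (hgap : 0 < gap u Xopt) (h : IsMatchUCBRun u T ε X τ) {ω : Ω}
    (hω : ω ∉ deviationEvent T ε X) {t : ℕ} (ht : t < T) (hs : ¬ IsStable u (X t ω) (τ t ω)) :
    ∃ a, (matchCount (fun s => X s ω) t a ((X t ω).partner a) : ℝ) ≤
      65536 * Fintype.card (Agent C P) ^ 2 * Real.log (Fintype.card (Agent C P) * T) /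
        gap u Xopt ^ 2 := by
  have hN2 : (2 : ℝ) ≤ Fintype.card (Agent C P) := by exact_mod_cast card_agent_ge_two C P
  have hT1 : (1 : ℝ) ≤ T := by exact_mod_cast Nat.one_le_of_lt ht
  have hNT : 1 ≤ (Fintype.card (Agent C P) : ℝ) * T := by nlinarith
  set Δ := gap u Xopt
  by_contra! hcon
  refine hs ((h.output t ht ω).isStable hu hgap (isConfSets_confSets _ _ _ _)
    (covers_confSets hu hω ht) fun a _ => ?_)
  have hlt := hcon a
  have hn : matchCount (fun s => X s ω) t a ((X t ω).partner a) ≠ 0 := by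
    intro h0
    rw [h0, Nat.cast_zero] at hlt
    have := Real.log_nonneg hNT
    exact absurd hlt (not_lt.2 (by positivity))
  refine (width_confSets_le _ _ _ _ _ _ hn).trans ?_
  have hrad := radius_sq_mul hn hNT
  have hr := radius_nonneg (Fintype.card (Agent C P)) T
    (matchCount (fun s => X s ω) t a ((X t ω).partner a))
  set n := matchCount (fun s => X s ω) t a ((X t ω).partner a)
  set r := radius (Fintype.card (Agent C P)) T n
  set N : ℝ := (Fintype.card (Agent C P) : ℝ)
  have hn' : (0 : ℝ) < n := Nat.cast_pos.2 (Nat.pos_of_ne_zero hn)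
  rw [div_lt_iff₀ (by positivity)] at hlt
  rw [le_div_iff₀ (by positivity)]
  -- Squaring 32rN ≤ Δ and inserting r²n = 64 log(NT) gives the constant 1024 · 64 = 65536.
  refine abs_le_of_sq_le_sq' (a := 2 * r * (16 * N)) ?_ hgap.le |>.2
  refine le_of_mul_le_mul_right ?_ hn'
  nlinarith

open Classical in
lemma IsMatchUCBRun.unstableRounds_le (hu : IsUnstructured u) {Xopt : Matching C P}
    (hgap : 0 < gap u Xopt) (h : IsMatchUCBRun u T ε X τ) (hT : 1 ≤ T) {ω : Ω}
    (hω : ω ∉ deviationEvent T ε X) :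
    (unstableRounds u T X τ ω : ℝ) ≤ (Fintype.card (Agent C P) : ℝ) ^ 2 *
      (65536 * Fintype.card (Agent C P) ^ 2 * Real.log (Fintype.card (Agent C P) * T) /
        gap u Xopt ^ 2 + 1) := by
  have hN2 : (2 : ℝ) ≤ Fintype.card (Agent C P) := by exact_mod_cast card_agent_ge_two C P
  have hT1 : (1 : ℝ) ≤ T := by exact_mod_cast hT
  have hlog := Real.log_nonneg (show 1 ≤ (Fintype.card (Agent C P) : ℝ) * T by nlinarith)
  set k := 65536 * (Fintype.card (Agent C P) : ℝ) ^ 2 *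
    Real.log (Fintype.card (Agent C P) * T) / gap u Xopt ^ 2 with hk
  have hk0 : 0 ≤ k := by positivity
  -- The union includes the pairs (a, a), since the agent with few observations is not known to be
  -- matched.
  have hsub : (Finset.range T).filter (fun t => ¬ IsStable u (X t ω) (τ t ω)) ⊆
      (Finset.univ : Finset (Agent C P × Agent C P)).biUnion fun x =>
        (Finset.range T).filter (fun t => (X t ω).partner x.1 = x.2 ∧
          (((Finset.range t).filter (fun s => (X s ω).partner x.1 = x.2)).card : ℝ) ≤ k) := by
    intro t ht
    obtain ⟨ht, hs⟩ := Finset.mem_filter.1 ht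
    obtain ⟨a, ha⟩ := h.exists_matchCount_le hu hgap hω (Finset.mem_range.1 ht) hs
    refine Finset.mem_biUnion.2 ⟨(a, (X t ω).partner a), Finset.mem_univ _,
      Finset.mem_filter.2 ⟨ht, rfl, ?_⟩⟩
    convert ha
    rw [matchCount]
  calc (unstableRounds u T X τ ω : ℝ)
      ≤ ∑ x : Agent C P × Agent C P, (((Finset.range T).filter (fun t =>
          (X t ω).partner x.1 = x.2 ∧ (((Finset.range t).filter
            (fun s => (X s ω).partner x.1 = x.2)).card : ℝ) ≤ k)).card : ℝ) := by
        exact_mod_cast (Finset.card_le_card hsub).trans Finset.card_biUnion_le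
    _ ≤ ∑ _x : Agent C P × Agent C P, (k + 1) :=
        Finset.sum_le_sum fun x _ =>
          card_filter_count_le (fun t => (X t ω).partner x.1 = x.2) T hk0
    _ = _ := by
        rw [Finset.sum_const, Finset.card_univ, Fintype.card_prod, nsmul_eq_mul]
        push_cast
        ring

end Counting

/-! ### Measurability of instability and stability -/

section Measurability

variable {C P Ω : Type*} [MeasurableSpace Ω]
  {X : Ω → Matching C P} {τ : Ω → Agent C P → ℝ}

lemma measurable_net (u : Agent C P → Agent C P → ℝ) (hX : Measurable X) (hτ : Measurable τ)
    (a : Agent C P) : Measurable fun ω => u a ((X ω).partner a) + τ ω a :=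
  ((measurable_from_top (f := fun Y : Matching C P => u a (Y.partner a))).comp hX).add
    ((measurable_pi_apply a).comp hτ)

variable [Finite C] [Finite P]

lemma measurable_instability (u : Agent C P → Agent C P → ℝ) (hX : Measurable X)
    (hτ : Measurable τ) : Measurable fun ω => instability u (X ω) (τ ω) :=
  Measurable.iSup fun S => measurable_const.sub
    (Finset.measurable_sum S fun a _ => measurable_net u hX hτ a)

lemma measurableSet_isStable (u : Agent C P → Agent C P → ℝ) (hX : Measurable X)
    (hτ : Measurable τ) : MeasurableSet {ω | IsStable u (X ω) (τ ω)} := by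
  have h : {ω | IsStable u (X ω) (τ ω)} =
      (⋂ a, {ω | 0 ≤ u a ((X ω).partner a) + τ ω a}) ∩
      ⋂ (c : C), ⋂ (p : P),
        {ω | u (Sum.inl c) (Sum.inr p) + u (Sum.inr p) (Sum.inl c) ≤
          (u (Sum.inl c) ((X ω).partner (Sum.inl c)) + τ ω (Sum.inl c)) +
          (u (Sum.inr p) ((X ω).partner (Sum.inr p)) + τ ω (Sum.inr p))} := by
    ext ω
    simp [IsStable]
  rw [h]
  refine (MeasurableSet.iInter fun a =>
    measurableSet_le measurable_const (measurable_net u hX hτ a)).inter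
    (MeasurableSet.iInter fun c => MeasurableSet.iInter fun p =>
      measurableSet_le measurable_const
        ((measurable_net u hX hτ _).add (measurable_net u hX hτ _)))

end Measurability

/-! ### Integrability, and means from tail bounds -/

section Main

variable {C P Ω : Type*} [Fintype C] [Fintype P] [MeasurableSpace Ω]
  {u : Agent C P → Agent C P → ℝ} {T : ℕ} {ε : ℕ → Agent C P → Ω → ℝ} {X : ℕ → Ω → Matching C P}
  {τ : ℕ → Ω → Agent C P → ℝ} {μ : Measure Ω}

lemma IsMatchUCBRun.measurable_regret (h : IsMatchUCBRun u T ε X τ) (hε : IsNoise μ ε) :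
    Measurable (regret u T X τ) :=
  Finset.measurable_sum _ fun t ht => measurable_instability u
    ((h.measurable_matching t (Finset.mem_range.1 ht)).mono (hε.past_le t) le_rfl)
    ((h.measurable_transfers t (Finset.mem_range.1 ht)).mono (hε.past_le t) le_rfl)

open Classical in
lemma IsMatchUCBRun.measurable_unstableRounds (h : IsMatchUCBRun u T ε X τ) (hε : IsNoise μ ε) :
    Measurable fun ω => (unstableRounds u T X τ ω : ℝ) := by
  simp only [unstableRounds, Finset.card_filter, Nat.cast_sum, Nat.cast_ite, Nat.cast_one,
    Nat.cast_zero]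
  refine Finset.measurable_sum _ fun t ht => Measurable.ite ?_ measurable_const measurable_const
  exact (measurableSet_isStable u
    ((h.measurable_matching t (Finset.mem_range.1 ht)).mono (hε.past_le t) le_rfl)
    ((h.measurable_transfers t (Finset.mem_range.1 ht)).mono (hε.past_le t) le_rfl)).compl

lemma IsMatchUCBRun.integrable_unstableRounds [IsFiniteMeasure μ] (h : IsMatchUCBRun u T ε X τ)
    (hε : IsNoise μ ε) : Integrable (fun ω => (unstableRounds u T X τ ω : ℝ)) μ := by
  refine Integrable.of_bound (h.measurable_unstableRounds hε).aestronglyMeasurable (T : ℝ)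
    (ae_of_all _ fun ω => ?_)
  rw [Real.norm_of_nonneg (Nat.cast_nonneg _)]
  exact_mod_cast unstableRounds_le_horizon u T X τ ω

lemma IsMatchUCBRun.integrable_regret [IsFiniteMeasure μ] (hu : IsUnstructured u)
    (h : IsMatchUCBRun u T ε X τ) (hε : IsNoise μ ε) : Integrable (regret u T X τ) μ := by
  refine ((h.integrable_unstableRounds hε).const_mul (4 * (Fintype.card (Agent C P) : ℝ))).mono'
    (h.measurable_regret hε).aestronglyMeasurable (ae_of_all _ fun ω => ?_)
  rw [Real.norm_of_nonneg (regret_nonneg u T X τ ω)]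
  exact h.regret_le hu ω

/-- The mean of a variable which rarely exceeds a bound `b`, and never a bound `B`. -/
lemma integral_le_of_measure_le [IsProbabilityMeasure μ] {f : Ω → ℝ} (hf : Measurable f)
    (hint : Integrable f μ) {b B r : ℝ} (hb : 0 ≤ b) (hB : 0 ≤ B) (hr : 0 ≤ r)
    (hfB : ∀ ω, f ω ≤ B) (hμ : μ {ω | b < f ω} ≤ ENNReal.ofReal r) :
    ∫ ω, f ω ∂μ ≤ b + B * r := by
  have hs : MeasurableSet {ω | b < f ω} := measurableSet_lt measurable_const hf
  have hI : Integrable ({ω | b < f ω}.indicator fun _ => B) μ :=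
    (integrable_const B).indicator hs
  calc ∫ ω, f ω ∂μ ≤ ∫ ω, (b + {ω | b < f ω}.indicator (fun _ => B) ω) ∂μ := by
        refine integral_mono hint ((integrable_const b).add hI) fun ω => ?_
        by_cases h : b < f ω
        · simpa [h] using (hfB ω).trans (le_add_of_nonneg_left hb)
        · simpa [h] using not_lt.1 h
    _ = b + μ.real {ω | b < f ω} * B := by
        rw [integral_add (integrable_const b) hI, integral_indicator_const _ hs]
        simp
    _ ≤ b + B * r := by
        rw [mul_comm]
        gcongr
        exact ENNReal.toReal_le_of_le_ofReal hr hμ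

end Main

end MatchingMarket

end

/-! ### Assembly of the bounds -/

theorem theorem6p1 :
    ∃ K : ℝ, 0 < K ∧
      ∀ (C P : Type*) [Fintype C] [Fintype P] [Nonempty C] [Nonempty P]
        (u : MatchingMarket.Agent C P → MatchingMarket.Agent C P → ℝ)
        (_ : MatchingMarket.IsUnstructured u)
        (Xopt : MatchingMarket.Matching C P) (_ : MatchingMarket.IsMaxWeight u Xopt)
        (Δ : ℝ) (_ : Δ = MatchingMarket.gap u Xopt) (_ : 0 < Δ)
        (T : ℕ) (_ : 1 ≤ T)
        (Ω : Type*) [MeasurableSpace Ω] (μ : Measure Ω) [IsProbabilityMeasure μ]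
        (ε : ℕ → MatchingMarket.Agent C P → Ω → ℝ) (_ : MatchingMarket.IsNoise μ ε)
        (X : ℕ → Ω → MatchingMarket.Matching C P)
        (τ : ℕ → Ω → MatchingMarket.Agent C P → ℝ)
        (_ : MatchingMarket.IsMatchUCBRun u T ε X τ),
        -- the expected regret
        (Integrable (MatchingMarket.regret u T X τ) μ ∧
          ∫ ω, MatchingMarket.regret u T X τ ω ∂μ ≤
            K * MatchingMarket.rate (Fintype.card (MatchingMarket.Agent C P)) T Δ) ∧
        -- the number of unstable rounds, in expectation
        (Integrable (fun ω => (MatchingMarket.unstableRounds u T X τ ω : ℝ)) μ ∧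
          ∫ ω, (MatchingMarket.unstableRounds u T X τ ω : ℝ) ∂μ ≤
            K * MatchingMarket.rate (Fintype.card (MatchingMarket.Agent C P)) T Δ) ∧
        -- the number of unstable rounds, with high probability
        μ {ω | K * MatchingMarket.rate (Fintype.card (MatchingMarket.Agent C P)) T Δ <
            (MatchingMarket.unstableRounds u T X τ ω : ℝ)} ≤
          ENNReal.ofReal
            (1 / ((Fintype.card (MatchingMarket.Agent C P) : ℝ) ^ 2 * (T : ℝ) ^ 2)) := by
  -- The regret needs the most: 4N · 65552 b = 262208 N b, where N b is the rate.
  refine ⟨300000, by norm_num, ?_⟩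
  intro C P _ _ _ _ u hu Xopt _ Δ hΔ hpos T hT Ω _ μ _ ε hε X τ h
  have hN2 : (2 : ℝ) ≤ Fintype.card (MatchingMarket.Agent C P) := by
    exact_mod_cast MatchingMarket.card_agent_ge_two C P
  have hT1 : (1 : ℝ) ≤ T := by exact_mod_cast hT
  have hΔN : Δ ≤ 2 * Fintype.card (MatchingMarket.Agent C P) :=
    hΔ ▸ MatchingMarket.gap_le_two_mul_card hu Xopt
  have hdev := hε.measure_deviationEvent_le hT h.measurable_matching
  have hclean : ∀ ω, ω ∉ MatchingMarket.deviationEvent T ε X →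
      (MatchingMarket.unstableRounds u T X τ ω : ℝ) ≤ _ :=
    fun ω hω => h.unstableRounds_le hu (hΔ ▸ hpos) hT hω
  have hreg := fun ω => h.regret_le hu ω
  have hRint := h.integrable_regret hu hε
  have hMint := h.integrable_unstableRounds hε
  rw [← hΔ] at hclean
  set N : ℝ := (Fintype.card (MatchingMarket.Agent C P) : ℝ) with hN
  have hlog : 1 / 2 ≤ Real.log (N * T) := by
    have h1 := Real.log_le_log (by norm_num) (show (2 : ℝ) ≤ N * T by nlinarith)
    linarith [Real.log_two_gt_d9]
  set b : ℝ := N ^ 4 * Real.log (N * T) / Δ ^ 2 with hb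
  have hrate : MatchingMarket.rate (Fintype.card (MatchingMarket.Agent C P)) T Δ = N * b := by
    rw [MatchingMarket.rate, hb, ← hN]; ring
  -- From Δ ≤ 2N and log(NT) ≥ 1/2. This absorbs the N² from the +1 per pair, and later the
  -- contribution, at most 1, of the bad event to the mean: 65536 + 8 + 8 = 65552.
  have hbN : N ^ 2 ≤ 8 * b := by
    rw [hb, ← mul_div_assoc, le_div_iff₀ (by positivity)]
    have h1 : Δ ^ 2 ≤ (2 * N) ^ 2 := by gcongr
    calc N ^ 2 * Δ ^ 2 ≤ N ^ 2 * (2 * N) ^ 2 := by gcongr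
      _ = 8 * (N ^ 4 * (1 / 2)) := by ring
      _ ≤ 8 * (N ^ 4 * Real.log (N * T)) := by gcongr
  have hb0 : 0 ≤ b := by nlinarith
  have hclean' : ∀ ω, ω ∉ MatchingMarket.deviationEvent T ε X →
      (MatchingMarket.unstableRounds u T X τ ω : ℝ) ≤ 65544 * b := by
    intro ω hω
    refine (hclean ω hω).trans ?_
    have : N ^ 2 * (65536 * N ^ 2 * Real.log (N * T) / Δ ^ 2 + 1) = 65536 * b + N ^ 2 := by
      rw [hb]; ring
    linarith
  have htail : μ {ω | 65544 * b < (MatchingMarket.unstableRounds u T X τ ω : ℝ)} ≤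
      ENNReal.ofReal (1 / (N ^ 2 * (T : ℝ) ^ 2)) :=
    (measure_mono fun ω hω => by
      by_contra hcon
      exact absurd (hclean' ω hcon) (not_le.2 hω)).trans hdev
  have hmean := MatchingMarket.integral_le_of_measure_le (h.measurable_unstableRounds hε) hMint
    (by positivity) (Nat.cast_nonneg T) (by positivity)
    (fun ω => by exact_mod_cast MatchingMarket.unstableRounds_le_horizon u T X τ ω) htail
  have hsmall : (T : ℝ) * (1 / (N ^ 2 * (T : ℝ) ^ 2)) ≤ 8 * b := by
    have h1 : (T : ℝ) * (1 / (N ^ 2 * (T : ℝ) ^ 2)) ≤ 1 := by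
      rw [mul_one_div, div_le_one (by positivity)]
      calc (T : ℝ) ≤ (T : ℝ) ^ 2 := le_self_pow₀ hT1 (by norm_num)
        _ ≤ N ^ 2 * (T : ℝ) ^ 2 := le_mul_of_one_le_left (by positivity) (by nlinarith)
    nlinarith
  have hM : ∫ ω, (MatchingMarket.unstableRounds u T X τ ω : ℝ) ∂μ ≤ 65552 * b := by linarith
  have hbNb : b ≤ N * b := by nlinarith
  rw [hrate]
  refine ⟨⟨hRint, ?_⟩, ⟨hMint, by linarith⟩, (measure_mono fun ω hω => ?_).trans htail⟩
  · calc ∫ ω, MatchingMarket.regret u T X τ ω ∂μ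
        ≤ ∫ ω, 4 * N * (MatchingMarket.unstableRounds u T X τ ω : ℝ) ∂μ :=
          integral_mono hRint (hMint.const_mul _) hreg
      _ = 4 * N * ∫ ω, (MatchingMarket.unstableRounds u T X τ ω : ℝ) ∂μ :=
          integral_const_mul _ _
      _ ≤ 4 * N * (65552 * b) := by gcongr
      _ ≤ 300000 * (N * b) := by nlinarith
  · rw [Set.mem_ofPred_eq] at hω ⊢
    linarith
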